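/- Let $r\ge 1$ and let $a(1),\dots,a(r)$ be distinct integers such that $\sum_{i=1}^{k-1}a(i)<a(k)$ for all $1\le k\le r$ and such that the $2^r-1$ sums of one or more distinct elements of $\{a(1),\dots,a(r)\}$ are pairwise distinct. Let $A'$ be the set of these sums and, for $\alpha\in A'$, let $w(\alpha)$ be the number of terms in the sum defining $\alpha$. Let $N\ge a(1)+\cdots+a(r)=\max A'$ be an integer, put $a(r+1)=N+a(1)$, and let $q,d$ be complex numbers with $0<|q|<1$ and $|d|<1$. Write $(x;q)_\infty=\prod_{j\ge0}(1-xq^j)$, and $${m \brack k}_q=\frac{(1-q^m)(1-q^{m-1})\cdots(1-q^{m-k+1})}{(1-q)(1-q^2)\cdots(1-q^k)}\ \text{ if } 0\le k\le m,\qquad {m \brack k}_q=0\ \text{ otherwise.}$$ Let $(u_\ell)_{\ell\ge0}$ be any sequence of complex numbers with $u_0=1$ that satisfies, for all $\ell\ge1$, the recurrence $(\mathrm{rec}_{N,r})$: $$\prod_{j=1}^{r}\left(1-dq^{\ell N-a(j)}\right)u_\ell=u_{\ell-1}+\sum_{j=1}^{r}\left(\sum_{m=0}^{r-j}d^m\sum_{\substack{\alpha\in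 A',\ \alpha<a(r+1)\\ w(\alpha)=j+m}}q^{\ell N-\alpha}\left((-1)^{m-1}q^{\ell(m-1)N}{j+m-1 \brack m-1}_{q^{-N}}+(-1)^mq^{\ell mN}{j+m \brack m}_{q^{-N}}\right)\right)\prod_{h=1}^{j-1}\left(1-q^{(\ell-h)N}\right)u_{\ell-j}$$ (for $j>\ell$ the product over $h$ contains the factor $1-q^0=0$, so the term with the undefined $u_{\ell-j}$ is understood to be $0$). Then $$\lim_{\ell\to\infty}u_\ell=\prod_{k=1}^r\frac{(-q^{N-a(k)};q^N)_\infty}{(dq^{N-a(k)};q^N)_\infty}.$$ -/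

import Mathlib

namespace SchurOverpartition

/-- The set `A'` of all sums of distinct elements of `A = {a 1, ..., a r}`
(sums over the nonempty sets of indices). -/
def subsetSums (a : ℕ → ℤ) (r : ℕ) : Finset ℤ :=
  ((Finset.Icc 1 r).powerset.filter (fun S => S.Nonempty)).image (fun S => ∑ i ∈ S, a i)

open Classical in
/-- `w(α)`: the number of terms in the defining sum of `α ∈ A'`. -/
noncomputable def weight (a : ℕ → ℤ) (r : ℕ) (α : ℤ) : ℕ :=
  if h : ∃ S : Finset ℕ, (S ⊆ Finset.Icc 1 r ∧ S.Nonempty) ∧ ∑ i ∈ S, a i = α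
  then h.choose.card else 0

/-- When the sums of distinct elements are pairwise distinct, `w` of the sum over `S` is `|S|`. -/
theorem weight_sum (a : ℕ → ℤ) (r : ℕ)
    (ha : Set.InjOn (fun S : Finset ℕ => ∑ i ∈ S, a i)
      {S : Finset ℕ | S ⊆ Finset.Icc 1 r ∧ S.Nonempty})
    (S : Finset ℕ) (hS : S ⊆ Finset.Icc 1 r) (hne : S.Nonempty) :
    weight a r (∑ i ∈ S, a i) = S.card := by
  have h : ∃ T : Finset ℕ, (T ⊆ Finset.Icc 1 r ∧ T.Nonempty) ∧ ∑ i ∈ T, a i = ∑ i ∈ S, a i :=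
    ⟨S, ⟨hS, hne⟩, rfl⟩
  have hT : h.choose = S := ha h.choose_spec.1 ⟨hS, hne⟩ h.choose_spec.2
  rw [weight, dif_pos h, hT]

/-- The `q`-binomial coefficient with integer entries, zero unless `0 ≤ k ≤ m`. -/
noncomputable def qBinom (q : ℂ) (m k : ℤ) : ℂ :=
  if 0 ≤ k ∧ k ≤ m then
    (∏ i ∈ Finset.range k.toNat, (1 - q ^ (m - (i : ℤ)))) /
      ∏ i ∈ Finset.range k.toNat, (1 - q ^ (i + 1))
  else 0

/-- The infinite `q`-shifted factorial `(x; q)_∞ = ∏_{j ≥ 0} (1 - x q ^ j)`. -/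
noncomputable def qPochInf (x q : ℂ) : ℂ := ∏' j : ℕ, (1 - x * q ^ j)

/-- For `|q| < 1` the product defining `(x; q)_∞` converges. -/
theorem hasProd_qPochInf (x q : ℂ) (hq : ‖q‖ < 1) :
    HasProd (fun j : ℕ => 1 - x * q ^ j) (qPochInf x q) := by
  have h : Multipliable (fun j : ℕ => 1 + -(x * q ^ j)) := by
    apply multipliable_one_add_of_summable
    simpa [norm_mul, norm_pow] using
      (summable_geometric_of_lt_one (norm_nonneg q) hq).mul_left ‖x‖
  simpa [sub_eq_add_neg, qPochInf] using h.hasProd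

/-- The coefficient attached to `j` and `ℓ` in the recurrence:
`∑_{m=0}^{r-j} d^m ∑_{α < a(r+1), w(α) = j+m} q^{ℓN-α} ((-1)^{m-1} q^{ℓ(m-1)N} [j+m-1, m-1]
  + (-1)^m q^{ℓmN} [j+m, m])`, with `q`-binomials in base `q^{-N}` and `a(r+1) = N + a(1)`. -/
noncomputable def recCoeff (a : ℕ → ℤ) (r N : ℕ) (q d : ℂ) (ℓ j : ℕ) : ℂ :=
  ∑ m ∈ Finset.range (r - j + 1), d ^ m *
    ∑ α ∈ (subsetSums a r).filter (fun α => α < (N : ℤ) + a 1 ∧ weight a r α = j + m),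
      q ^ ((ℓ : ℤ) * N - α) *
        ((-1) ^ ((m : ℤ) - 1) * q ^ ((ℓ : ℤ) * ((m : ℤ) - 1) * N) *
            qBinom (q ^ (-(N : ℤ))) ((j : ℤ) + m - 1) ((m : ℤ) - 1) +
          (-1) ^ m * q ^ (ℓ * m * N) * qBinom (q ^ (-(N : ℤ))) ((j : ℤ) + m) (m : ℤ))

/-- The recurrence `(rec_{N,r})` for a sequence indexed by `ℕ`, at all `ℓ ≥ 1`.
When `j > ℓ` the product over `h` contains the factor `1 - q ^ 0 = 0` (at `h = ℓ`), so the term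
involving the entry of negative index `ℓ - j` vanishes and the truncated subtraction is harmless. -/
def SatisfiesRec (a : ℕ → ℤ) (r N : ℕ) (q d : ℂ) (u : ℕ → ℂ) : Prop :=
  ∀ ℓ : ℕ, 1 ≤ ℓ →
    (∏ j ∈ Finset.Icc 1 r, (1 - d * q ^ ((ℓ : ℤ) * N - a j))) * u ℓ =
      u (ℓ - 1) + ∑ j ∈ Finset.Icc 1 r, recCoeff a r N q d ℓ j *
        (∏ h ∈ Finset.Icc 1 (j - 1), (1 - q ^ (((ℓ : ℤ) - h) * N))) * u (ℓ - j)

end SchurOverpartition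

namespace SchurOverpartition

open Finset Filter Topology

/-! ### The q-binomial coefficients in base `Q⁻¹`. -/

section algebra

/-! Put `Q = q ^ N`, `y i = q ^ (-a i)` and e(t) = ∏ (1 + y_i t). Since N is at least the sum of all
a(i), the condition α < a(r+1) excludes nothing, and the sums over α of weight k assemble into
elementary symmetric polynomials e_k of the y_i (`recCoeff_eq`).

Let f(t) = ∏ (-Q y_i t; Q)_∞ / (t; Q)_∞, the solution of (1 - t) f(t) = e(Qt) f(Qt) with f(0) = 1.
Replacing t^k by the polynomial b_k = (x - dη)^k 1, with η the dilation x ↦ Qx, turns f into a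
series in x with coefficients V_ℓ = `hermiteTransform Q d f ℓ`. Multiplication by t becomes x - dη,
whose powers expand by a noncommutative q-binomial theorem in base `Q⁻¹`; this is the source of the
q-binomials in the recurrence. The functional equation of f becomes a recurrence for V
(`IsProductSeries.hermiteTransform_rec`), and (Q; Q)_ℓ V_ℓ then satisfies the given one. Its leading
factor never vanishes, so u_ℓ = (Q; Q)_ℓ V_ℓ / V_0.

For the limit, V_0 = f(-d), and f_k tends to L = ∏ (-Q y_i; Q)_∞ / (Q; Q)_∞. By dominated
convergence and Euler's series, V_ℓ tends to L / (-d; Q)_∞. The factors (Q; Q)_∞ and (-d; Q)_∞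
cancel in the quotient (`tendsto_of_rec`). -/

lemma one_sub_pow_ne_zero {Q : ℂ} (hQ : ‖Q‖ < 1) (i : ℕ) : 1 - Q ^ (i + 1) ≠ 0 := by
  intro h
  have h1 : ‖Q ^ (i + 1)‖ = 1 := by rw [← sub_eq_zero.mp h, norm_one]
  rw [norm_pow] at h1
  exact (pow_lt_one₀ (norm_nonneg Q) hQ (Nat.succ_ne_zero i)).ne h1

lemma one_sub_inv_pow_ne_zero {Q : ℂ} (hQ : ‖Q‖ < 1) (i : ℕ) :
    1 - Q⁻¹ ^ (i + 1) ≠ 0 := by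
  intro h
  apply one_sub_pow_ne_zero hQ i
  have h2 : (Q ^ (i + 1))⁻¹ = 1 := by rw [← inv_pow]; exact (sub_eq_zero.mp h).symm
  rw [inv_eq_one.mp h2, sub_self]

/-- For k > n the numerator contains the zero factor i = n, so natural arguments need no case split.
-/
lemma qBinom_natCast (q : ℂ) (n k : ℕ) :
    qBinom q n k = (∏ i ∈ range k, (1 - q ^ ((n : ℤ) - (i : ℤ)))) /
      ∏ i ∈ range k, (1 - q ^ (i + 1)) := by
  unfold qBinom
  split_ifs with h
  · simp
  · have hk : n < k := by
      by_contra hk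
      exact h ⟨by positivity, by exact_mod_cast not_lt.mp hk⟩
    rw [prod_eq_zero (mem_range.mpr hk) (by simp), zero_div]

lemma qBinom_zero_right (q : ℂ) (n : ℕ) : qBinom q n 0 = 1 := by
  simpa using qBinom_natCast q n 0

lemma qBinom_of_neg (q : ℂ) (n k : ℤ) (hk : k < 0) : qBinom q n k = 0 := by
  rw [qBinom, if_neg]
  omega

lemma qBinom_of_lt (q : ℂ) (n k : ℤ) (hk : n < k) : qBinom q n k = 0 := by
  rw [qBinom, if_neg]
  omega

lemma qBinom_self {Q : ℂ} (hQ : ‖Q‖ < 1) (n : ℕ) : qBinom Q⁻¹ n n = 1 := by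
  rw [qBinom_natCast, ← prod_range_reflect (fun i => 1 - Q⁻¹ ^ (i + 1))]
  have h : ∏ i ∈ range n, (1 - Q⁻¹ ^ ((n : ℤ) - (i : ℤ))) =
      ∏ i ∈ range n, (1 - Q⁻¹ ^ (n - 1 - i + 1)) := by
    refine prod_congr rfl fun i hi => ?_
    have := mem_range.mp hi
    rw [← zpow_natCast]
    congr 2
    omega
  rw [h, div_self]
  exact prod_ne_zero_iff.mpr fun i _ => one_sub_inv_pow_ne_zero hQ _

/-- The q-Pascal rule that drives the induction in `hermiteTransform_shift_nat`. -/
lemma qBinom_succ_succ {Q : ℂ} (hQ0 : Q ≠ 0) (hQ : ‖Q‖ < 1) (n k : ℕ) :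
    qBinom Q⁻¹ ((n : ℤ) + 1) ((k : ℤ) + 1) =
      qBinom Q⁻¹ n k + Q⁻¹ ^ (k + 1) * qBinom Q⁻¹ n ((k : ℤ) + 1) := by
  have h1 := qBinom_natCast Q⁻¹ (n + 1) (k + 1)
  have h2 := qBinom_natCast Q⁻¹ n (k + 1)
  have h3 := qBinom_natCast Q⁻¹ n k
  push_cast at h1 h2
  have hnum : ∏ i ∈ range (k + 1), (1 - Q⁻¹ ^ ((n : ℤ) + 1 - (i : ℤ))) =
      (∏ i ∈ range k, (1 - Q⁻¹ ^ ((n : ℤ) - (i : ℤ)))) * (1 - Q⁻¹ ^ (n + 1)) := by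
    rw [prod_range_succ']
    congr 1
    · refine prod_congr rfl fun i _ => ?_
      push_cast
      ring_nf
  rw [h1, h2, h3, hnum, prod_range_succ, prod_range_succ]
  have hp0 : Q⁻¹ ≠ 0 := inv_ne_zero hQ0
  have hP : ∏ i ∈ range k, (1 - Q⁻¹ ^ (i + 1)) ≠ 0 :=
    prod_ne_zero_iff.mpr fun i _ => one_sub_inv_pow_ne_zero hQ i
  have hk := one_sub_inv_pow_ne_zero hQ k
  have hz : Q⁻¹ ^ (n + 1) = Q⁻¹ ^ (k + 1) * Q⁻¹ ^ ((n : ℤ) - (k : ℤ)) := by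
    rw [← zpow_natCast, ← zpow_natCast, ← zpow_add₀ hp0]
    congr 1
    push_cast
    ring
  rw [hz]
  generalize Q⁻¹ ^ ((n : ℤ) - (k : ℤ)) = z at *
  generalize Q⁻¹ ^ (k + 1) = w at *
  field_simp
  ring

end algebra

/-! ### Gaussian coefficients with integer argument and the transform. -/

/-- The Gaussian binomial coefficient `[ℓ + m, m]` in base `Q`, for an arbitrary integer `ℓ`. -/
noncomputable def gaussShift (Q : ℂ) (ℓ : ℤ) (m : ℕ) : ℂ :=
  ∏ i ∈ range m, (1 - Q ^ (ℓ + ((i : ℤ) + 1))) / (1 - Q ^ (i + 1))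

/-- The coefficients, in powers of `x`, of `∑ f k * b k`, where `b k = (x - d η) ^ k 1` and `η` is
the dilation `x ↦ Q x`. -/
noncomputable def hermiteTransform (Q d : ℂ) (f : ℤ → ℂ) (ℓ : ℤ) : ℂ :=
  ∑' m : ℕ, (-d) ^ m * gaussShift Q ℓ m * f (ℓ + m)

lemma gaussShift_zero (Q : ℂ) (ℓ : ℤ) : gaussShift Q ℓ 0 = 1 := by simp [gaussShift]

lemma gaussShift_succ_mul {Q : ℂ} (hQ : ‖Q‖ < 1) (ℓ : ℤ) (m : ℕ) :
    gaussShift Q ℓ (m + 1) * (1 - Q ^ (m + 1)) =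
      gaussShift Q ℓ m * (1 - Q ^ (ℓ + ((m : ℤ) + 1))) := by
  have := one_sub_pow_ne_zero hQ m
  rw [gaussShift, prod_range_succ, ← gaussShift]
  field_simp

lemma gaussShift_sub_one_mul {Q : ℂ} (hQ : ‖Q‖ < 1) (ℓ : ℤ) (m : ℕ) :
    gaussShift Q (ℓ - 1) (m + 1) * (1 - Q ^ (m + 1)) = gaussShift Q ℓ m * (1 - Q ^ ℓ) := by
  induction m with
  | zero =>
    have := one_sub_pow_ne_zero hQ 0
    simp [gaussShift] at *
    field_simp
  | succ m ih =>
    have h1 := gaussShift_succ_mul hQ (ℓ - 1) (m + 1)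
    have h2 := gaussShift_succ_mul hQ ℓ m
    have hm := one_sub_pow_ne_zero hQ m
    have hz : ℓ - 1 + (((m + 1 : ℕ) : ℤ) + 1) = ℓ + ((m : ℤ) + 1) := by push_cast; ring
    rw [hz] at h1
    rw [h1]
    apply mul_right_cancel₀ hm
    linear_combination (1 - Q ^ (ℓ + ((m : ℤ) + 1))) * ih - (1 - Q ^ ℓ) * h2

/-- The coefficient form of b_{k+1} = (x - dη) b_k, valid for negative ℓ as well. -/
lemma gaussShift_succ {Q : ℂ} (hQ0 : Q ≠ 0) (hQ : ‖Q‖ < 1) (ℓ : ℤ) (m : ℕ) :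
    gaussShift Q ℓ (m + 1) = gaussShift Q (ℓ - 1) (m + 1) + Q ^ ℓ * gaussShift Q ℓ m := by
  apply mul_right_cancel₀ (one_sub_pow_ne_zero hQ m)
  have hz : Q ^ (ℓ + ((m : ℤ) + 1)) = Q ^ ℓ * Q ^ (m + 1) := by
    rw [zpow_add₀ hQ0]; norm_cast
  rw [add_mul, gaussShift_succ_mul hQ, gaussShift_sub_one_mul hQ, hz]
  ring

lemma gaussShift_zero_left {Q : ℂ} (hQ : ‖Q‖ < 1) (m : ℕ) : gaussShift Q 0 m = 1 := by
  refine prod_eq_one fun i _ => ?_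
  have := one_sub_pow_ne_zero hQ i
  rw [zero_add]
  norm_cast
  exact div_self this

/-- The factor i = -ℓ - 1 of the product is 1 - Q^0 = 0. -/
lemma gaussShift_of_neg (Q : ℂ) (ℓ : ℤ) (m : ℕ) (hℓ : ℓ < 0) (hm : 0 ≤ ℓ + m) :
    gaussShift Q ℓ m = 0 := by
  refine prod_eq_zero (i := (-ℓ - 1).toNat) (mem_range.mpr (by omega)) ?_
  have : ℓ + (((-ℓ - 1).toNat : ℤ) + 1) = 0 := by omega
  rw [this]
  simp

/-- The sequence vanishes at negative indices. -/
lemma hermiteTransform_of_neg (Q d : ℂ) (f : ℤ → ℂ) (hf : ∀ k < 0, f k = 0) (ℓ : ℤ)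
    (hℓ : ℓ < 0) : hermiteTransform Q d f ℓ = 0 := by
  have : ∀ m : ℕ, (-d) ^ m * gaussShift Q ℓ m * f (ℓ + m) = 0 := by
    intro m
    rcases lt_or_ge (ℓ + (m : ℤ)) 0 with h | h
    · simp [hf _ h]
    · simp [gaussShift_of_neg Q ℓ m hℓ h]
  simp [hermiteTransform, this]

/-! ### Uniform bounds and summability. -/

section bounds

lemma prod_one_add_geometric_le {ρ c : ℝ} (hρ0 : 0 ≤ ρ) (hρ : ρ < 1) (hc : 0 ≤ c) (k : ℕ) :
    ∏ i ∈ range k, (1 + c * ρ ^ i) ≤ Real.exp (c / (1 - ρ)) := by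
  calc ∏ i ∈ range k, (1 + c * ρ ^ i) ≤ ∏ i ∈ range k, Real.exp (c * ρ ^ i) := by
        refine prod_le_prod (fun i _ => by positivity) fun i _ => ?_
        rw [add_comm]; exact Real.add_one_le_exp _
    _ = Real.exp (c * ∑ i ∈ range k, ρ ^ i) := by rw [← Real.exp_sum, mul_sum]
    _ ≤ Real.exp (c / (1 - ρ)) := by
        rw [div_eq_mul_inv, ← tsum_geometric_of_lt_one hρ0 hρ]
        gcongr
        exact (summable_geometric_of_lt_one hρ0 hρ).sum_le_tsum _ fun i _ => by positivity

lemma prod_one_sub_inv_le {Q : ℂ} (hQ : ‖Q‖ < 1) (m : ℕ) :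
    ∏ i ∈ range m, ‖1 - Q ^ (i + 1)‖⁻¹ ≤ Real.exp ((1 - ‖Q‖)⁻¹ / (1 - ‖Q‖)) := by
  have h0 : 0 < 1 - ‖Q‖ := by linarith
  refine le_trans (prod_le_prod (fun i _ => by positivity) fun i _ => ?_)
    (prod_one_add_geometric_le (norm_nonneg Q) hQ (inv_nonneg.mpr h0.le) m)
  have h1 : 1 - ‖Q‖ ^ (i + 1) ≤ ‖1 - Q ^ (i + 1)‖ := by
    have := norm_sub_norm_le (1 : ℂ) (Q ^ (i + 1))
    rwa [norm_one, norm_pow] at this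
  have h2 : ‖Q‖ ^ (i + 1) ≤ ‖Q‖ := pow_le_of_le_one (norm_nonneg Q) hQ.le (Nat.succ_ne_zero i)
  have h3 : 0 < 1 - ‖Q‖ ^ (i + 1) := by linarith
  refine (inv_anti₀ h3 h1).trans ?_
  have h4 : ‖Q‖ ^ (i + 1) ≤ ‖Q‖ ^ i := pow_le_pow_of_le_one (norm_nonneg Q) hQ.le (Nat.le_succ i)
  have h5 : (1 - ‖Q‖ ^ (i + 1))⁻¹ ≤ (1 - ‖Q‖)⁻¹ := inv_anti₀ h0 (by linarith)
  -- This splitting gives each factor the shape 1 + c ρ^i with c = 1 / (1 - ρ), ρ = ‖Q‖.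
  have h6 : (1 - ‖Q‖ ^ (i + 1))⁻¹ = 1 + (1 - ‖Q‖ ^ (i + 1))⁻¹ * ‖Q‖ ^ (i + 1) := by
    field_simp; ring
  rw [h6]
  gcongr

/-- Uniform in m, hence summability against d^m. The dependence on ℓ is only through ‖Q‖^ℓ, which is
at most 1 for ℓ ≥ 0; this later supplies the dominating function as ℓ → ∞. -/
lemma norm_gaussShift_le {Q : ℂ} (hQ0 : Q ≠ 0) (hQ : ‖Q‖ < 1) (ℓ : ℤ) (m : ℕ) :
    ‖gaussShift Q ℓ m‖ ≤
      Real.exp (‖Q‖ ^ ℓ / (1 - ‖Q‖)) * Real.exp ((1 - ‖Q‖)⁻¹ / (1 - ‖Q‖)) := by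
  rw [gaussShift, prod_div_distrib, norm_div, div_eq_mul_inv, norm_prod, norm_prod, ← prod_inv_distrib]
  have h0 : 0 < ‖Q‖ := norm_pos_iff.mpr hQ0
  refine mul_le_mul ?_ (prod_one_sub_inv_le hQ m) (by positivity) (by positivity)
  refine le_trans (prod_le_prod (fun i _ => norm_nonneg _) fun i _ => ?_)
    (prod_one_add_geometric_le h0.le hQ (zpow_nonneg h0.le ℓ) m)
  refine (norm_sub_le _ _).trans ?_
  rw [norm_one, norm_zpow, zpow_add₀ h0.ne']
  gcongr
  norm_cast
  exact pow_le_pow_of_le_one h0.le hQ.le (Nat.le_succ i)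

lemma summable_hermiteTransform {Q d : ℂ} (hQ0 : Q ≠ 0) (hQ : ‖Q‖ < 1) (hd : ‖d‖ < 1)
    {f : ℤ → ℂ} {M : ℝ} (hf : ∀ k, ‖f k‖ ≤ M) (ℓ : ℤ) :
    Summable fun m : ℕ => (-d) ^ m * gaussShift Q ℓ m * f (ℓ + m) := by
  refine Summable.of_norm_bounded (((summable_geometric_of_lt_one (norm_nonneg d) hd).mul_right
    (Real.exp (‖Q‖ ^ ℓ / (1 - ‖Q‖)) * Real.exp ((1 - ‖Q‖)⁻¹ / (1 - ‖Q‖)))).mul_right M) fun m => ?_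
  rw [norm_mul, norm_mul, norm_pow, norm_neg]
  have := norm_gaussShift_le hQ0 hQ ℓ m
  have := hf (ℓ + m)
  gcongr

end bounds

/-! ### How the transform intertwines multiplication by t and dilation. -/

section transform

variable {Q d : ℂ}

lemma hermiteTransform_add (hQ0 : Q ≠ 0) (hQ : ‖Q‖ < 1) (hd : ‖d‖ < 1) {f g : ℤ → ℂ} {M M' : ℝ}
    (hf : ∀ k, ‖f k‖ ≤ M) (hg : ∀ k, ‖g k‖ ≤ M') (ℓ : ℤ) :
    hermiteTransform Q d (fun k => f k + g k) ℓ =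
      hermiteTransform Q d f ℓ + hermiteTransform Q d g ℓ := by
  rw [hermiteTransform, hermiteTransform, hermiteTransform,
    ← (summable_hermiteTransform hQ0 hQ hd hf ℓ).tsum_add (summable_hermiteTransform hQ0 hQ hd hg ℓ)]
  simp only [mul_add]

lemma hermiteTransform_const_mul (c : ℂ) (f : ℤ → ℂ) (ℓ : ℤ) :
    hermiteTransform Q d (fun k => c * f k) ℓ = c * hermiteTransform Q d f ℓ := by
  rw [hermiteTransform, hermiteTransform, ← tsum_mul_left]
  exact tsum_congr fun m => by ring

lemma hermiteTransform_sum (hQ0 : Q ≠ 0) (hQ : ‖Q‖ < 1) (hd : ‖d‖ < 1) (s : Finset ℕ)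
    {f : ℕ → ℤ → ℂ} {M : ℕ → ℝ} (hf : ∀ i k, ‖f i k‖ ≤ M i) (ℓ : ℤ) :
    hermiteTransform Q d (fun k => ∑ i ∈ s, f i k) ℓ = ∑ i ∈ s, hermiteTransform Q d (f i) ℓ := by
  simp only [hermiteTransform, mul_sum]
  exact Summable.tsum_finsetSum fun i _ => summable_hermiteTransform hQ0 hQ hd (hf i) ℓ

/-- Multiplication by the variable corresponds to the operator `x - d η`. -/
lemma hermiteTransform_shift (hQ0 : Q ≠ 0) (hQ : ‖Q‖ < 1) (hd : ‖d‖ < 1) {f : ℤ → ℂ} {M : ℝ}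
    (hf : ∀ k, ‖f k‖ ≤ M) (ℓ : ℤ) :
    hermiteTransform Q d (fun k => f (k - 1)) ℓ =
      hermiteTransform Q d f (ℓ - 1) - d * Q ^ ℓ * hermiteTransform Q d f ℓ := by
  have hA := summable_hermiteTransform hQ0 hQ hd (f := fun k => f (k - 1)) (fun k => hf _) ℓ
  have hB := summable_hermiteTransform hQ0 hQ hd hf (ℓ - 1)
  have hC := summable_hermiteTransform hQ0 hQ hd hf ℓ
  simp only [hermiteTransform]
  rw [hA.tsum_eq_zero_add, hB.tsum_eq_zero_add, ← tsum_mul_left,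
    add_sub_assoc ((-d) ^ 0 * gaussShift Q (ℓ - 1) 0 * f (ℓ - 1 + ((0 : ℕ) : ℤ))),
    ← Summable.tsum_sub ((summable_nat_add_iff 1).mpr hB) (hC.mul_left (d * Q ^ ℓ))]
  congr 1
  · simp [gaussShift_zero]
  · refine tsum_congr fun m => ?_
    have h1 : ℓ + ((m + 1 : ℕ) : ℤ) - 1 = ℓ + m := by push_cast; ring
    have h2 : ℓ - 1 + ((m + 1 : ℕ) : ℤ) = ℓ + m := by push_cast; ring
    rw [h1, h2, gaussShift_succ hQ0 hQ]
    ring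

/-- The noncommutative `q`-binomial theorem for the powers of `x - d η`. -/
lemma hermiteTransform_shift_nat (hQ0 : Q ≠ 0) (hQ : ‖Q‖ < 1) (hd : ‖d‖ < 1) {f : ℤ → ℂ} {M : ℝ}
    (hf : ∀ k, ‖f k‖ ≤ M) (n : ℕ) (ℓ : ℤ) :
    hermiteTransform Q d (fun k => f (k - n)) ℓ =
      ∑ m ∈ range (n + 1), (-d) ^ m * qBinom Q⁻¹ n m * (Q ^ ℓ) ^ m *
        hermiteTransform Q d f (ℓ - n + m) := by
  induction n generalizing ℓ with
  | zero => simp [qBinom]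
  | succ n ih =>
    have h := hermiteTransform_shift hQ0 hQ hd (f := fun k => f (k - n)) (fun k => hf _) ℓ
    have e : (fun k : ℤ => f (k - ((n + 1 : ℕ) : ℤ))) = fun k => f (k - 1 - n) := by
      funext k; congr 1; push_cast; ring
    rw [e, h, ih, ih, sum_range_succ' _ (n + 1), mul_sum]
    have h1 : ∀ m : ℕ, (Q ^ (ℓ - 1)) ^ m = (Q ^ ℓ) ^ m * Q⁻¹ ^ m := by
      intro m
      rw [zpow_sub₀ hQ0, zpow_one, div_eq_mul_inv, mul_pow]
    have h2 : ∑ m ∈ range (n + 1), (-d) ^ m * qBinom Q⁻¹ n m * (Q ^ (ℓ - 1)) ^ m *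
          hermiteTransform Q d f (ℓ - 1 - n + m) =
        ∑ m ∈ range (n + 1), (-d) ^ (m + 1) * (Q⁻¹ ^ (m + 1) * qBinom Q⁻¹ n ((m : ℤ) + 1)) *
          (Q ^ ℓ) ^ (m + 1) * hermiteTransform Q d f (ℓ - n + m) +
        hermiteTransform Q d f (ℓ - 1 - n) := by
      -- The extra term m = n + 1 carries [n, n+1] = 0. With it, splitting off m = 0 leaves the same
      -- range as the other sum, ready for the Pascal rule.
      have h3 : ∑ m ∈ range (n + 2), (-d) ^ m * qBinom Q⁻¹ n m * (Q ^ (ℓ - 1)) ^ m *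
          hermiteTransform Q d f (ℓ - 1 - n + m) = ∑ m ∈ range (n + 1), (-d) ^ m *
          qBinom Q⁻¹ n m * (Q ^ (ℓ - 1)) ^ m * hermiteTransform Q d f (ℓ - 1 - n + m) := by
        rw [sum_range_succ _ (n + 1), qBinom_of_lt _ _ _ (by push_cast; omega)]
        ring
      rw [← h3, sum_range_succ' _ (n + 1)]
      congr 1
      · refine sum_congr rfl fun m _ => ?_
        have : ℓ - 1 - n + ((m + 1 : ℕ) : ℤ) = ℓ - n + m := by push_cast; ring
        rw [this, h1]
        push_cast
        ring
      · simp [qBinom_zero_right]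
    rw [h2, add_sub_right_comm, ← sum_sub_distrib]
    congr 1
    · refine sum_congr rfl fun m _ => ?_
      have : ℓ - ((n + 1 : ℕ) : ℤ) + ((m + 1 : ℕ) : ℤ) = ℓ - n + m := by push_cast; ring
      rw [this]
      push_cast
      rw [qBinom_succ_succ hQ0 hQ]
      ring
    · have := qBinom_zero_right Q⁻¹ (n + 1)
      push_cast at this ⊢
      rw [this]
      have : ℓ - 1 - (n : ℤ) = ℓ - (n + 1) + 0 := by ring
      rw [this]
      simp

/-- The action of the dilation `η`. -/
lemma hermiteTransform_dilate (hQ0 : Q ≠ 0) (hQ : ‖Q‖ < 1) (hd : ‖d‖ < 1) {s c : ℤ → ℂ} {M M' : ℝ}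
    (hs : ∀ k, ‖s k‖ ≤ M) (hc : ∀ k, ‖c k‖ ≤ M') (hcs : ∀ k, c k = Q ^ k * s k) (ℓ : ℤ) :
    hermiteTransform Q d c ℓ =
      Q ^ ℓ * hermiteTransform Q d (fun k => s k + d * (s (k + 1) - c (k + 1))) ℓ := by
  have hY := summable_hermiteTransform hQ0 hQ hd hs ℓ
  have hX := summable_hermiteTransform hQ0 hQ hd hc ℓ
  have hsc : ∀ k, ‖s (k + 1) - c (k + 1)‖ ≤ M + M' := fun k =>
    (norm_sub_le _ _).trans (add_le_add (hs _) (hc _))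
  have hdsc : ∀ k, ‖d * (s (k + 1) - c (k + 1))‖ ≤ ‖d‖ * (M + M') := fun k => by
    rw [norm_mul]; exact mul_le_mul_of_nonneg_left (hsc k) (norm_nonneg d)
  have hZ := summable_hermiteTransform hQ0 hQ hd hdsc ℓ
  rw [hermiteTransform_add hQ0 hQ hd hs hdsc]
  -- The ratio of consecutive Gaussian coefficients trades 1 - Q^(ℓ+m+1) for 1 - Q^(m+1), so the
  -- series is a shift of `-w` below; since `w 0 = 0`, no boundary term appears.
  have hw : ∀ m : ℕ, (-d) ^ m * gaussShift Q ℓ m * (d * (s (ℓ + m + 1) - c (ℓ + m + 1))) =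
      -((-d) ^ (m + 1) * gaussShift Q ℓ (m + 1) * (1 - Q ^ (m + 1)) * s (ℓ + (m + 1 : ℕ))) := by
    intro m
    have e : ℓ + (m : ℤ) + 1 = ℓ + ((m + 1 : ℕ) : ℤ) := by push_cast; ring
    have e2 : ℓ + ((m : ℤ) + 1) = ℓ + ((m + 1 : ℕ) : ℤ) := by push_cast; ring
    have h := gaussShift_succ_mul hQ ℓ m
    rw [e2] at h
    rw [e, hcs]
    linear_combination (-d) ^ (m + 1) * s (ℓ + (m + 1 : ℕ)) * h
  set w : ℕ → ℂ := fun m => (-d) ^ m * gaussShift Q ℓ m * (1 - Q ^ m) * s (ℓ + m) with hwdef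
  have hw1 : Summable fun m => w (m + 1) := by
    refine hZ.neg.congr fun m => ?_
    rw [hw m]; simp [hwdef]
  have hw' : hermiteTransform Q d (fun k => d * (s (k + 1) - c (k + 1))) ℓ = -∑' m, w m := by
    rw [((summable_nat_add_iff 1).mp hw1).tsum_eq_zero_add]
    simp only [hwdef, hermiteTransform, hw, tsum_neg]
    simp
  rw [hw', ← sub_eq_add_neg, hermiteTransform, hermiteTransform,
    ← hY.tsum_sub ((summable_nat_add_iff 1).mp hw1), ← tsum_mul_left]
  refine tsum_congr fun m => ?_
  have hz : Q ^ (ℓ + (m : ℤ)) = Q ^ ℓ * Q ^ m := by rw [zpow_add₀ hQ0, zpow_natCast]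
  rw [hcs, hz, hwdef]
  ring

end transform

/-! ### Power series solutions of the functional equation: existence and boundedness. -/

/-- `f` lists the coefficients of a power series with constant term `1` such that
`(1 - t) f(t) = e(Q t) f(Q t)`, where `e(t) = ∑ i ≤ r, e i * t ^ i`. -/
structure IsProductSeries (e : ℕ → ℂ) (r : ℕ) (Q : ℂ) (f : ℤ → ℂ) : Prop where
  of_neg : ∀ k < 0, f k = 0
  zero : f 0 = 1
  sub_eq : ∀ k, f k - f (k - 1) = Q ^ k * ∑ i ∈ range (r + 1), e i * f (k - i)

/-- The nonnegative part of the solution of the recurrence in `IsProductSeries`. -/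
noncomputable def productCoeff (e : ℕ → ℂ) (Q : ℂ) : ℕ → ℂ
  | 0 => 1
  | n + 1 => (productCoeff e Q n +
      Q ^ (n + 1) * ∑ i : Fin (n + 1), e (i + 1) * productCoeff e Q (n - i)) / (1 - Q ^ (n + 1))

lemma exists_isProductSeries (e : ℕ → ℂ) (r : ℕ) {Q : ℂ} (hQ : ‖Q‖ < 1) (he0 : e 0 = 1)
    (her : ∀ i, r < i → e i = 0) : ∃ f, IsProductSeries e r Q f := by
  set f : ℤ → ℂ := fun k => if k < 0 then 0 else productCoeff e Q k.toNat with hf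
  have hneg : ∀ k < 0, f k = 0 := fun k hk => by simp [hf, hk]
  have hnat : ∀ n : ℕ, f n = productCoeff e Q n := fun n => by simp [hf]
  have h0 : f 0 = 1 := by
    have := hnat 0
    rw [productCoeff] at this
    exact_mod_cast this
  refine ⟨f, hneg, h0, fun k => ?_⟩
  rcases lt_trichotomy k 0 with hk | rfl | hk
  · rw [hneg k hk, hneg (k - 1) (by omega), sum_eq_zero]
    · simp
    · intro i _
      rw [hneg (k - i) (by omega), mul_zero]
  · rw [hneg (0 - 1) (by omega), sum_range_succ', sum_eq_zero]
    · simp [h0, he0]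
    · intro i _
      rw [hneg _ (by push_cast; omega), mul_zero]
  · obtain ⟨n, rfl⟩ : ∃ n : ℕ, k = (n + 1 : ℕ) := ⟨(k - 1).toNat, by omega⟩
    have hk1 : ((n + 1 : ℕ) : ℤ) - 1 = n := by push_cast; ring
    -- Past r the `e i` vanish and past n + 1 the values of `f` vanish, so both sums equal the one
    -- over `range (r + n + 2)`.
    have hsum : ∑ i ∈ range (r + 1), e i * f ((n + 1 : ℕ) - i) =
        ∑ i ∈ range (n + 2), e i * f ((n + 1 : ℕ) - i) := by
      have h1 : ∑ i ∈ range (r + 1), e i * f ((n + 1 : ℕ) - i) =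
          ∑ i ∈ range (r + n + 2), e i * f ((n + 1 : ℕ) - i) := by
        refine sum_subset (range_mono (by omega)) fun i _ hi => ?_
        rw [her i (by simpa using hi), zero_mul]
      have h2 : ∑ i ∈ range (n + 2), e i * f ((n + 1 : ℕ) - i) =
          ∑ i ∈ range (r + n + 2), e i * f ((n + 1 : ℕ) - i) := by
        refine sum_subset (range_mono (by omega)) fun i _ hi => ?_
        have : n + 2 ≤ i := by simpa using hi
        rw [hneg _ (by push_cast; omega), mul_zero]
      rw [h1, h2]
    have hfin : ∑ i : Fin (n + 1), e (i + 1) * productCoeff e Q (n - i) =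
        ∑ i ∈ range (n + 1), e (i + 1) * f ((n + 1 : ℕ) - (i + 1 : ℕ)) := by
      rw [← Fin.sum_univ_eq_sum_range fun i => e (i + 1) * f ((n + 1 : ℕ) - (i + 1 : ℕ))]
      refine sum_congr rfl fun i _ => ?_
      have : ((n + 1 : ℕ) : ℤ) - (((i : ℕ) + 1 : ℕ) : ℤ) = ((n - i : ℕ) : ℤ) := by
        have := i.2
        omega
      rw [this, hnat]
    have hrec : f (n + 1 : ℕ) = (f n + Q ^ (n + 1) *
        ∑ i ∈ range (n + 1), e (i + 1) * f ((n + 1 : ℕ) - (i + 1 : ℕ))) / (1 - Q ^ (n + 1)) := by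
      rw [hnat, hnat, productCoeff, hfin]
    have hq := one_sub_pow_ne_zero hQ n
    rw [eq_div_iff hq] at hrec
    rw [hk1, hsum, sum_range_succ' _ (n + 1), he0, zpow_natCast, Nat.cast_zero, sub_zero]
    linear_combination hrec

/-- Solving the recurrence for f_{n+1} multiplies the running bound by at most (1 + A ρ^(n+1)) / (1
- ρ^(n+1)) ≤ 1 + c ρ^n, and the product of these factors converges. -/
lemma IsProductSeries.exists_bound {e : ℕ → ℂ} {r : ℕ} {Q : ℂ} {f : ℤ → ℂ}
    (hf : IsProductSeries e r Q f) (hQ : ‖Q‖ < 1) (he0 : e 0 = 1) : ∃ M : ℝ, ∀ k, ‖f k‖ ≤ M := by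
  set ρ := ‖Q‖ with hρ
  have hρ0 : 0 ≤ ρ := norm_nonneg Q
  have h1ρ : 0 < 1 - ρ := by linarith
  set A : ℝ := ∑ i ∈ range r, ‖e (i + 1)‖ with hA
  have hA0 : 0 ≤ A := sum_nonneg fun i _ => norm_nonneg _
  -- Chosen so that (1 - ρ) c = 1 + A, which is what `h4` needs.
  set c : ℝ := (1 + A) / (1 - ρ) with hc
  have hc0 : 0 ≤ c := by positivity
  set b : ℕ → ℝ := fun n => ∏ i ∈ range n, (1 + c * ρ ^ i) with hb
  have hbmono : Monotone b := by
    refine monotone_nat_of_le_succ fun n => ?_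
    simp only [hb]
    rw [prod_range_succ]
    refine le_mul_of_one_le_right (prod_nonneg fun i _ => by positivity) ?_
    have : 0 ≤ c * ρ ^ n := by positivity
    linarith
  have hb0 : ∀ n, 0 ≤ b n := fun n => prod_nonneg fun i _ => by positivity
  have key : ∀ n : ℕ, ∀ k : ℤ, k ≤ n → ‖f k‖ ≤ b n := by
    intro n
    induction n with
    | zero =>
      intro k hk
      rcases lt_or_eq_of_le hk with h | h
      · simp [hf.of_neg k (by simpa using h), hb]
      · simp only [Nat.cast_zero] at h
        simp [h, hf.zero, hb]
    | succ n ih =>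
      intro k hk
      rcases lt_or_eq_of_le hk with h | h
      · exact (ih k (by push_cast at h; omega)).trans (hbmono (Nat.le_succ n))
      · have hr := hf.sub_eq k
        rw [sum_range_succ', he0, Nat.cast_zero, sub_zero, one_mul] at hr
        have hzp : Q ^ k = Q ^ (n + 1) := by rw [h, zpow_natCast]
        rw [hzp] at hr
        have hr' : (1 - Q ^ (n + 1)) * f k = f (k - 1) +
            Q ^ (n + 1) * ∑ i ∈ range r, e (i + 1) * f (k - (i + 1 : ℕ)) := by
          linear_combination hr
        have hS : ‖∑ i ∈ range r, e (i + 1) * f (k - (i + 1 : ℕ))‖ ≤ A * b n := by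
          rw [hA, sum_mul]
          refine norm_sum_le_of_le _ fun i _ => ?_
          rw [norm_mul]
          exact mul_le_mul_of_nonneg_left (ih _ (by push_cast at h ⊢; omega)) (norm_nonneg _)
        have hpow : ρ ^ (n + 1) ≤ ρ := pow_le_of_le_one hρ0 hQ.le (Nat.succ_ne_zero n)
        have hpow' : ρ ^ (n + 1) ≤ ρ ^ n := pow_le_pow_of_le_one hρ0 hQ.le (Nat.le_succ n)
        have hlow : 1 - ρ ^ (n + 1) ≤ ‖1 - Q ^ (n + 1)‖ := by
          have := norm_sub_norm_le (1 : ℂ) (Q ^ (n + 1))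
          rwa [norm_one, norm_pow] at this
        have hup : ‖(1 - Q ^ (n + 1)) * f k‖ ≤ b n + ρ ^ (n + 1) * (A * b n) := by
          rw [hr']
          refine (norm_add_le _ _).trans (add_le_add (ih _ (by push_cast at h; omega)) ?_)
          rw [norm_mul, norm_pow]
          exact mul_le_mul_of_nonneg_left hS (by positivity)
        rw [norm_mul] at hup
        have hpos : 0 < 1 - ρ ^ (n + 1) := by linarith
        have h2 : (1 - ρ ^ (n + 1)) * ‖f k‖ ≤ b n + ρ ^ (n + 1) * (A * b n) :=
          (mul_le_mul_of_nonneg_right hlow (norm_nonneg _)).trans hup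
        have h3 : b n + ρ ^ (n + 1) * (A * b n) ≤ (1 - ρ ^ (n + 1)) * b (n + 1) := by
          simp only [hb]
          rw [prod_range_succ]
          have hP := hb0 n
          simp only [hb] at hP
          have h4 : 1 + ρ ^ (n + 1) * A ≤ (1 - ρ ^ (n + 1)) * (1 + c * ρ ^ n) := by
            have h5 : (1 + A) * ρ ^ n ≤ (1 - ρ ^ (n + 1)) * (c * ρ ^ n) := by
              have : (1 + A) * ρ ^ n = (1 - ρ) * (c * ρ ^ n) := by
                rw [hc]; field_simp
              rw [this]
              have : 0 ≤ c * ρ ^ n := by positivity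
              exact mul_le_mul_of_nonneg_right (by linarith) this
            have h6 : (1 + A) * ρ ^ (n + 1) ≤ (1 + A) * ρ ^ n :=
              mul_le_mul_of_nonneg_left hpow' (by positivity)
            linarith
          have := mul_le_mul_of_nonneg_left h4 hP
          linarith
        exact le_of_mul_le_mul_left (h2.trans h3) hpos
  refine ⟨Real.exp (c / (1 - ρ)), fun k => ?_⟩
  exact (key k.toNat k (by omega)).trans (prod_one_add_geometric_le hρ0 hQ hc0 _)

/-! ### From the functional equation to the recurrence for the transform. -/

section recurrence

variable {e : ℕ → ℂ} {r : ℕ} {Q d : ℂ} {f : ℤ → ℂ} {M : ℝ}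

/-- The functional equation pushed through `hermiteTransform_dilate`, with s the coefficients of
e(t) f(t) and c those of (1 - t) f(t). -/
lemma IsProductSeries.hermiteTransform_eq (hf : IsProductSeries e r Q f) (he0 : e 0 = 1)
    (hQ0 : Q ≠ 0) (hQ : ‖Q‖ < 1) (hd : ‖d‖ < 1) (hM : ∀ k, ‖f k‖ ≤ M) (ℓ : ℤ) :
    hermiteTransform Q d f ℓ = hermiteTransform Q d f (ℓ - 1) +
      Q ^ ℓ * (hermiteTransform Q d f ℓ + ∑ i ∈ range r, e (i + 1) *
        (hermiteTransform Q d (fun k => f (k - (i + 1 : ℕ))) ℓ +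
          d * hermiteTransform Q d (fun k => f (k - i)) ℓ)) := by
  have hs : ∀ k : ℤ, ‖∑ i ∈ range (r + 1), e i * f (k - i)‖ ≤ ∑ i ∈ range (r + 1), ‖e i‖ * M := by
    refine fun k => norm_sum_le_of_le _ fun i _ => ?_
    rw [norm_mul]
    exact mul_le_mul_of_nonneg_left (hM _) (norm_nonneg _)
  have hc : ∀ k : ℤ, ‖f k - f (k - 1)‖ ≤ M + M := fun k =>
    (norm_sub_le _ _).trans (add_le_add (hM _) (hM _))
  have h := hermiteTransform_dilate hQ0 hQ hd hs hc hf.sub_eq ℓ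
  have hterm : ∀ (i : ℕ) (k : ℤ), ‖e (i + 1) * (f (k - (i + 1 : ℕ)) + d * f (k - i))‖ ≤
      ‖e (i + 1)‖ * (M + ‖d‖ * M) := by
    intro i k
    rw [norm_mul]
    refine mul_le_mul_of_nonneg_left ((norm_add_le _ _).trans (add_le_add (hM _) ?_))
      (norm_nonneg _)
    rw [norm_mul]
    exact mul_le_mul_of_nonneg_left (hM _) (norm_nonneg _)
  have hsumb : ∀ k : ℤ, ‖∑ i ∈ range r, e (i + 1) * (f (k - (i + 1 : ℕ)) + d * f (k - i))‖ ≤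
      ∑ i ∈ range r, ‖e (i + 1)‖ * (M + ‖d‖ * M) := fun k =>
    norm_sum_le_of_le _ fun i _ => hterm i k
  have hdf : ∀ k : ℤ, ‖(1 + d) * f k‖ ≤ ‖1 + d‖ * M := fun k => by
    rw [norm_mul]; exact mul_le_mul_of_nonneg_left (hM _) (norm_nonneg _)
  -- Because `e 0 = 1`, the terms `f (k + 1)` cancel: the index shift introduces no coefficient
  -- beyond `f k`.
  have e1 : (fun k : ℤ => ∑ i ∈ range (r + 1), e i * f (k - i) +
      d * (∑ i ∈ range (r + 1), e i * f (k + 1 - i) - (f (k + 1) - f (k + 1 - 1)))) =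
      fun k => (1 + d) * f k +
        ∑ i ∈ range r, e (i + 1) * (f (k - (i + 1 : ℕ)) + d * f (k - i)) := by
    funext k
    rw [sum_range_succ', sum_range_succ' _ r, he0]
    have h1 : ∀ i : ℕ, k + 1 - ((i + 1 : ℕ) : ℤ) = k - i := fun i => by push_cast; ring
    simp only [h1, mul_add, sum_add_distrib, Nat.cast_zero, sub_zero, add_sub_cancel_right]
    have h2 : ∑ i ∈ range r, e (i + 1) * (d * f (k - i)) =
        d * ∑ i ∈ range r, e (i + 1) * f (k - i) := by
      rw [mul_sum]; exact sum_congr rfl fun i _ => by ring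
    rw [h2]
    ring
  have e2 : hermiteTransform Q d (fun k => f k - f (k - 1)) ℓ =
      hermiteTransform Q d f ℓ - (hermiteTransform Q d f (ℓ - 1) -
        d * Q ^ ℓ * hermiteTransform Q d f ℓ) := by
    have h3 := hermiteTransform_add hQ0 hQ hd hM (g := fun k => -1 * f (k - 1)) (M' := M)
      (fun k => by simpa using hM (k - 1)) ℓ
    rw [hermiteTransform_const_mul, hermiteTransform_shift hQ0 hQ hd hM] at h3
    have h4 : (fun k => f k - f (k - 1)) = fun k => f k + -1 * f (k - 1) := by
      funext k; ring
    rw [h4, h3]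
    ring
  rw [e2, e1, hermiteTransform_add hQ0 hQ hd hdf hsumb, hermiteTransform_const_mul,
    hermiteTransform_sum hQ0 hQ hd _ hterm] at h
  have e3 : ∀ i : ℕ, hermiteTransform Q d
      (fun k => e (i + 1) * (f (k - (i + 1 : ℕ)) + d * f (k - i))) ℓ = e (i + 1) *
        (hermiteTransform Q d (fun k => f (k - (i + 1 : ℕ))) ℓ +
          d * hermiteTransform Q d (fun k => f (k - i)) ℓ) := by
    intro i
    rw [hermiteTransform_const_mul, hermiteTransform_add hQ0 hQ hd (fun k => hM _)
      (g := fun k => d * f (k - i)) (M' := ‖d‖ * M) (fun k => by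
        rw [norm_mul]; exact mul_le_mul_of_nonneg_left (hM _) (norm_nonneg _)),
      hermiteTransform_const_mul]
  simp only [e3] at h
  linear_combination h

/-- The factor of the recurrence that carries the two `q`-binomial coefficients. -/
noncomputable def recBracket (Q : ℂ) (ℓ k : ℤ) (m : ℕ) : ℂ :=
  (-1) ^ ((m : ℤ) - 1) * Q ^ (ℓ * ((m : ℤ) - 1)) * qBinom Q⁻¹ (k - 1) ((m : ℤ) - 1) +
    (-1) ^ m * Q ^ (ℓ * m) * qBinom Q⁻¹ k m

/-- At m = 0 the first q-binomial has lower index -1 and vanishes. -/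
lemma recBracket_zero (Q : ℂ) (ℓ : ℤ) (k : ℕ) : recBracket Q ℓ k 0 = 1 := by
  rw [recBracket, qBinom_of_neg _ _ _ (by simp)]
  simp [qBinom_zero_right]

lemma recBracket_succ (Q : ℂ) (ℓ : ℤ) (k : ℤ) (m : ℕ) : recBracket Q ℓ (k + 1) (m + 1) =
    (-1) ^ m * (Q ^ ℓ) ^ m * qBinom Q⁻¹ k m +
      (-1) ^ (m + 1) * (Q ^ ℓ) ^ (m + 1) * qBinom Q⁻¹ (k + 1) ((m : ℤ) + 1) := by
  rw [recBracket]
  push_cast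
  rw [add_sub_cancel_right, add_sub_cancel_right, zpow_natCast, zpow_mul, zpow_natCast, zpow_mul]
  norm_cast

lemma recBracket_self (hQ : ‖Q‖ < 1) (ℓ : ℤ) (n : ℕ) :
    recBracket Q ℓ ((n : ℤ) + 1) (n + 1) = (-1) ^ n * (Q ^ ℓ) ^ n * (1 - Q ^ ℓ) := by
  have h := qBinom_self hQ (n + 1)
  push_cast at h
  rw [recBracket_succ, qBinom_self hQ, h]
  ring

/-- Expanding (x - dη)^(n+1) + d (x - dη)^n and collecting equal indices of V pairs the two
q-binomials of the bracket. -/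
lemma hermiteTransform_shift_add (hQ0 : Q ≠ 0) (hQ : ‖Q‖ < 1) (hd : ‖d‖ < 1)
    (hM : ∀ k, ‖f k‖ ≤ M) (n : ℕ) (ℓ : ℤ) :
    hermiteTransform Q d (fun k => f (k - (n + 1 : ℕ))) ℓ +
        d * hermiteTransform Q d (fun k => f (k - n)) ℓ =
      ∑ m ∈ range (n + 2), d ^ m * recBracket Q ℓ ((n : ℤ) + 1) m *
        hermiteTransform Q d f (ℓ - (n + 1) + m) := by
  rw [hermiteTransform_shift_nat hQ0 hQ hd hM, hermiteTransform_shift_nat hQ0 hQ hd hM,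
    sum_range_succ', sum_range_succ' _ (n + 1), mul_sum, add_right_comm, ← sum_add_distrib]
  congr 1
  · refine sum_congr rfl fun m _ => ?_
    have h1 : ℓ - ((n + 1 : ℕ) : ℤ) + ((m + 1 : ℕ) : ℤ) = ℓ - n + m := by push_cast; ring
    have h2 : ℓ - ((n : ℤ) + 1) + ((m + 1 : ℕ) : ℤ) = ℓ - n + m := by push_cast; ring
    rw [h1, h2, recBracket_succ, neg_pow d, neg_pow d]
    push_cast
    ring
  · have h1 := recBracket_zero Q ℓ (n + 1)
    push_cast at h1
    rw [h1]
    have h2 := qBinom_zero_right Q⁻¹ (n + 1)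
    push_cast at h2 ⊢
    rw [h2]
    simp

/-- The recurrence satisfied by the transform of a product series. -/
lemma IsProductSeries.hermiteTransform_rec (hf : IsProductSeries e r Q f) (he0 : e 0 = 1)
    (hQ0 : Q ≠ 0) (hQ : ‖Q‖ < 1) (hd : ‖d‖ < 1) (hM : ∀ k, ‖f k‖ ≤ M) (ℓ : ℤ) :
    (1 - Q ^ ℓ) * (∑ i ∈ range (r + 1), e i * (-(d * Q ^ ℓ)) ^ i) * hermiteTransform Q d f ℓ =
      hermiteTransform Q d f (ℓ - 1) + ∑ j ∈ Icc 1 r, (∑ m ∈ range (r - j + 1),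
        d ^ m * (Q ^ ℓ * e (j + m) * recBracket Q ℓ ((j : ℤ) + m) m)) *
          hermiteTransform Q d f (ℓ - j) := by
  have h := hf.hermiteTransform_eq he0 hQ0 hQ hd hM ℓ
  simp only [hermiteTransform_shift_add hQ0 hQ hd hM] at h
  -- The top term m = i + 1 contains V_ℓ itself; moved to the left side, these terms build the
  -- factor (1 - Q^ℓ) e(-d Q^ℓ).
  have h1 : ∀ i : ℕ, ∑ m ∈ range (i + 2), d ^ m * recBracket Q ℓ ((i : ℤ) + 1) m *
        hermiteTransform Q d f (ℓ - (i + 1) + m) =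
      ∑ m ∈ range (i + 1), d ^ m * recBracket Q ℓ ((i : ℤ) + 1) m *
        hermiteTransform Q d f (ℓ - (i + 1) + m) -
      (-(d * Q ^ ℓ)) ^ (i + 1) * (Q ^ ℓ)⁻¹ * (1 - Q ^ ℓ) * hermiteTransform Q d f ℓ := by
    intro i
    rw [sum_range_succ _ (i + 1), recBracket_self hQ]
    have h2 : ℓ - ((i : ℤ) + 1) + ((i + 1 : ℕ) : ℤ) = ℓ := by push_cast; ring
    have h3 : Q ^ ℓ ≠ 0 := zpow_ne_zero _ hQ0
    rw [h2, neg_pow (d * Q ^ ℓ), mul_pow]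
    field_simp
    ring
  simp only [h1, mul_sub (e _), sum_sub_distrib] at h
  have h4 : ∑ i ∈ range r, e (i + 1) * ∑ m ∈ range (i + 1), d ^ m *
        recBracket Q ℓ ((i : ℤ) + 1) m * hermiteTransform Q d f (ℓ - (i + 1) + m) =
      ∑ j ∈ Icc 1 r, ∑ m ∈ range (r - j + 1), e (j + m) * (d ^ m *
        recBracket Q ℓ ((j : ℤ) + m) m * hermiteTransform Q d f (ℓ - j)) := by
    simp only [mul_sum]
    rw [sum_sigma', sum_sigma']
    -- Reindexing by i + 1 = j + m.
    refine sum_bij' (fun x _ => ⟨x.1 + 1 - x.2, x.2⟩) (fun x _ => ⟨x.1 + x.2 - 1, x.2⟩) ?_ ?_ ?_ ?_ ?_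
    · rintro ⟨i, m⟩ hx
      simp only [mem_sigma, mem_range, mem_Icc] at hx ⊢
      omega
    · rintro ⟨j, m⟩ hx
      simp only [mem_sigma, mem_range, mem_Icc] at hx ⊢
      omega
    · rintro ⟨i, m⟩ hx
      simp only [mem_sigma, mem_range] at hx ⊢
      ext
      · simp; omega
      · simp
    · rintro ⟨j, m⟩ hx
      simp only [mem_sigma, mem_range, mem_Icc] at hx ⊢
      ext
      · simp; omega
      · simp
    · rintro ⟨i, m⟩ hx
      simp only [mem_sigma, mem_range] at hx
      have e1 : i + 1 - m + m = i + 1 := by omega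
      have e2 : ((i + 1 - m : ℕ) : ℤ) + m = i + 1 := by omega
      have e3 : ℓ - ((i + 1 - m : ℕ) : ℤ) = ℓ - (i + 1) + m := by omega
      simp only [e1, e2, e3]
  have h5 : ∑ j ∈ Icc 1 r, (∑ m ∈ range (r - j + 1),
        d ^ m * (Q ^ ℓ * e (j + m) * recBracket Q ℓ ((j : ℤ) + m) m)) *
          hermiteTransform Q d f (ℓ - j) =
      Q ^ ℓ * ∑ j ∈ Icc 1 r, ∑ m ∈ range (r - j + 1), e (j + m) * (d ^ m *
        recBracket Q ℓ ((j : ℤ) + m) m * hermiteTransform Q d f (ℓ - j)) := by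
    simp only [mul_sum, sum_mul]
    exact sum_congr rfl fun j _ => sum_congr rfl fun m _ => by ring
  have h6 : Q ^ ℓ * ∑ i ∈ range r, e (i + 1) * ((-(d * Q ^ ℓ)) ^ (i + 1) * (Q ^ ℓ)⁻¹ *
      (1 - Q ^ ℓ) * hermiteTransform Q d f ℓ) =
      (∑ i ∈ range r, e (i + 1) * (-(d * Q ^ ℓ)) ^ (i + 1)) * (1 - Q ^ ℓ) *
        hermiteTransform Q d f ℓ := by
    have h3 : Q ^ ℓ ≠ 0 := zpow_ne_zero _ hQ0
    simp only [mul_sum, sum_mul]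
    refine sum_congr rfl fun i _ => ?_
    field_simp
  rw [h4] at h
  rw [h5, sum_range_succ', he0]
  linear_combination h - h6

end recurrence

/-! ### Infinite products, Euler's series and limits of coefficients. -/

section analysis

variable {e : ℕ → ℂ} {r : ℕ} {Q : ℂ} {f : ℤ → ℂ} {M : ℝ}

lemma summable_mul_pow (hM : ∀ k, ‖f k‖ ≤ M) {z : ℂ} (hz : ‖z‖ < 1) (j : ℤ) :
    Summable fun k : ℕ => f (k - j) * z ^ k := by
  refine Summable.of_norm_bounded
    ((summable_geometric_of_lt_one (norm_nonneg z) hz).mul_left M) fun k => ?_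
  rw [norm_mul, norm_pow]
  exact mul_le_mul_of_nonneg_right (hM _) (by positivity)

lemma tsum_shift_mul_pow (hneg : ∀ k < 0, f k = 0) (hM : ∀ k, ‖f k‖ ≤ M) {z : ℂ}
    (hz : ‖z‖ < 1) (i : ℕ) :
    ∑' k : ℕ, f (k - i) * z ^ k = z ^ i * ∑' k : ℕ, f k * z ^ k := by
  induction i with
  | zero => simp
  | succ i ih =>
    rw [(summable_mul_pow hM hz _).tsum_eq_zero_add, hneg _ (by push_cast; omega), zero_mul,
      zero_add, pow_succ', mul_assoc, ← ih, ← tsum_mul_left]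
    refine tsum_congr fun k => ?_
    have : ((k + 1 : ℕ) : ℤ) - ((i + 1 : ℕ) : ℤ) = k - i := by push_cast; ring
    rw [this]
    ring

lemma hasSum_convolution_mul_pow (hneg : ∀ k < 0, f k = 0) (hM : ∀ k, ‖f k‖ ≤ M) {z : ℂ}
    (hz : ‖z‖ < 1) : HasSum (fun k : ℕ => (∑ i ∈ range (r + 1), e i * f (k - i)) * z ^ k)
      ((∑ i ∈ range (r + 1), e i * z ^ i) * ∑' k : ℕ, f k * z ^ k) := by
  have h := hasSum_sum (s := range (r + 1)) fun i _ =>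
    ((summable_mul_pow hM hz i).hasSum.mul_left (e i))
  simp only [tsum_shift_mul_pow hneg hM hz] at h
  simpa only [sum_mul, mul_assoc] using h

lemma norm_mul_lt_one_of_lt_one {z : ℂ} (hQ : ‖Q‖ < 1) (hz : ‖z‖ ≤ 1) : ‖Q * z‖ < 1 := by
  rw [norm_mul]
  exact mul_lt_one_of_nonneg_of_lt_one_left (norm_nonneg Q) hQ hz

lemma IsProductSeries.one_sub_mul_tsum (hf : IsProductSeries e r Q f) (hQ : ‖Q‖ < 1)
    (hM : ∀ k, ‖f k‖ ≤ M) {z : ℂ} (hz : ‖z‖ < 1) :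
    (1 - z) * ∑' k : ℕ, f k * z ^ k =
      (∑ i ∈ range (r + 1), e i * (Q * z) ^ i) * ∑' k : ℕ, f k * (Q * z) ^ k := by
  rw [← (hasSum_convolution_mul_pow hf.of_neg hM (norm_mul_lt_one_of_lt_one hQ hz.le)).tsum_eq]
  have h1 := tsum_shift_mul_pow hf.of_neg hM hz 1
  have h2 : Summable fun k : ℕ => f k * z ^ k := by simpa using summable_mul_pow hM hz 0
  have h3 : Summable fun k : ℕ => f (k - (1 : ℕ)) * z ^ k := summable_mul_pow hM hz _
  rw [pow_one] at h1
  rw [sub_mul, one_mul, ← h1, ← h2.tsum_sub h3]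
  refine tsum_congr fun k => ?_
  have h4 := hf.sub_eq k
  rw [zpow_natCast] at h4
  rw [mul_pow, Nat.cast_one]
  linear_combination z ^ k * h4

lemma tendsto_tsum_pow_zero (hM : ∀ k, ‖f k‖ ≤ M) (hQ : ‖Q‖ < 1) {z : ℂ} (hz : ‖z‖ < 1) :
    Tendsto (fun n : ℕ => ∑' k : ℕ, f k * (z * Q ^ n) ^ k) atTop (𝓝 (f 0)) := by
  have h : Tendsto (fun n : ℕ => ∑' k : ℕ, f k * (z * Q ^ n) ^ k) atTop
      (𝓝 (∑' k : ℕ, f k * (0 : ℂ) ^ k)) := by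
    refine tendsto_tsum_of_dominated_convergence (bound := fun k => M * ‖z‖ ^ k)
      ((summable_geometric_of_lt_one (norm_nonneg z) hz).mul_left M) (fun k => ?_) ?_
    · have h1 : Tendsto (fun n : ℕ => z * Q ^ n) atTop (𝓝 0) := by
        simpa using (tendsto_pow_atTop_nhds_zero_of_norm_lt_one hQ).const_mul z
      exact (h1.pow k).const_mul _
    · refine Eventually.of_forall fun n k => ?_
      rw [norm_mul, norm_pow, norm_mul, norm_pow]
      have h2 : ‖z‖ * ‖Q‖ ^ n ≤ ‖z‖ :=
        mul_le_of_le_one_right (norm_nonneg z) (pow_le_one₀ (norm_nonneg Q) hQ.le)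
      exact mul_le_mul (hM _) (pow_le_pow_left₀ (by positivity) h2 k) (by positivity)
        ((norm_nonneg _).trans (hM 0))
  rw [tsum_eq_single 0 (fun k hk => by rw [zero_pow hk, mul_zero])] at h
  simpa using h

lemma tendsto_qPochInf (x : ℂ) (hQ : ‖Q‖ < 1) :
    Tendsto (fun n : ℕ => ∏ j ∈ range n, (1 - x * Q ^ j)) atTop (𝓝 (qPochInf x Q)) :=
  (hasProd_qPochInf x Q hQ).tendsto_prod_nat

lemma qPochInf_eq_mul (x : ℂ) (hQ : ‖Q‖ < 1) :
    qPochInf x Q = (1 - x) * qPochInf (x * Q) Q := by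
  refine tendsto_nhds_unique ((tendsto_add_atTop_iff_nat 1).mpr (tendsto_qPochInf x hQ)) ?_
  refine ((tendsto_qPochInf (x * Q) hQ).const_mul (1 - x)).congr fun n => ?_
  rw [prod_range_succ', mul_comm, pow_zero, mul_one]
  congr 1
  exact prod_congr rfl fun j _ => by ring

variable {I : Finset ℕ} {y : ℕ → ℂ}

/-- The generating function of `f` is the quotient of infinite products. -/
lemma IsProductSeries.tsum_mul_qPochInf (hf : IsProductSeries e r Q f) (hQ : ‖Q‖ < 1)
    (hM : ∀ k, ‖f k‖ ≤ M)
    (he : ∀ t, ∑ i ∈ range (r + 1), e i * t ^ i = ∏ i ∈ I, (1 + y i * t))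
    {z : ℂ} (hz : ‖z‖ < 1) :
    (∑' k : ℕ, f k * z ^ k) * qPochInf z Q = ∏ i ∈ I, qPochInf (-(Q * z * y i)) Q := by
  -- The functional equation iterated n times; as n → ∞ the remaining factor f(z Q^n) tends to f(0)
  -- = 1.
  have key : ∀ n : ℕ, (∑' k : ℕ, f k * z ^ k) * ∏ j ∈ range n, (1 - z * Q ^ j) =
      (∏ i ∈ I, ∏ j ∈ range n, (1 - -(Q * z * y i) * Q ^ j)) *
        ∑' k : ℕ, f k * (z * Q ^ n) ^ k := by
    intro n
    induction n with
    | zero => simp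
    | succ n ih =>
      have hzn : ‖z * Q ^ n‖ < 1 := by
        rw [norm_mul, norm_pow]
        exact mul_lt_one_of_nonneg_of_lt_one_left (norm_nonneg z) hz
          (pow_le_one₀ (norm_nonneg Q) hQ.le)
      have h := hf.one_sub_mul_tsum hQ hM hzn
      have e1 : Q * (z * Q ^ n) = z * Q ^ (n + 1) := by ring
      rw [he, e1] at h
      simp only [prod_range_succ, prod_mul_distrib]
      rw [← mul_assoc, ih, mul_assoc, mul_comm _ (1 - z * Q ^ n), h, ← mul_assoc]
      congr 2
      exact prod_congr rfl fun i _ => by ring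
  refine tendsto_nhds_unique ((tendsto_qPochInf z hQ).const_mul _) ?_
  simp only [key]
  have h1 : Tendsto (fun n => ∏ i ∈ I, ∏ j ∈ range n, (1 - -(Q * z * y i) * Q ^ j)) atTop
      (𝓝 (∏ i ∈ I, qPochInf (-(Q * z * y i)) Q)) :=
    tendsto_finsetProd _ fun i _ => tendsto_qPochInf _ hQ
  simpa [hf.zero] using h1.mul (tendsto_tsum_pow_zero hM hQ hz)

/-- The coefficients converge to the residue of the generating function at `1`. -/
lemma IsProductSeries.exists_tendsto (hf : IsProductSeries e r Q f) (hQ : ‖Q‖ < 1)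
    (hM : ∀ k, ‖f k‖ ≤ M)
    (he : ∀ t, ∑ i ∈ range (r + 1), e i * t ^ i = ∏ i ∈ I, (1 + y i * t)) :
    ∃ L, Tendsto (fun n : ℕ => f n) atTop (𝓝 L) ∧
      L * qPochInf Q Q = ∏ i ∈ I, qPochInf (-(Q * y i)) Q := by
  have h := hasSum_convolution_mul_pow (e := e) (r := r) hf.of_neg hM hQ
  -- By telescoping, f_n is a partial sum of ∑ Q^k (e f)_k, so the limit is e(Q) f(Q).
  refine ⟨(∑ i ∈ range (r + 1), e i * Q ^ i) * ∑' k : ℕ, f k * Q ^ k, ?_, ?_⟩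
  · refine ((tendsto_add_atTop_iff_nat 1).mpr h.tendsto_sum_nat).congr fun n => ?_
    have hk : ∀ k : ℕ, (∑ i ∈ range (r + 1), e i * f (k - i)) * Q ^ k = f k - f (k - 1) := by
      intro k
      rw [hf.sub_eq, zpow_natCast, mul_comm]
    simp only [hk]
    induction n with
    | zero => simp [hf.of_neg]
    | succ n ih =>
      rw [sum_range_succ, ih]
      push_cast
      ring_nf
  · rw [mul_assoc, hf.tsum_mul_qPochInf hQ hM he hQ, he, ← prod_mul_distrib]
    refine prod_congr rfl fun i _ => ?_
    rw [qPochInf_eq_mul (-(Q * y i)) hQ]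
    congr 1
    · ring
    · congr 1
      ring

lemma sum_range_one_mul_pow (t : ℂ) :
    ∑ i ∈ range (0 + 1), (Pi.single 0 1 : ℕ → ℂ) i * t ^ i =
      ∏ i ∈ (∅ : Finset ℕ), (1 + (0 : ℕ → ℂ) i * t) := by
  simp

/-- The Euler series `∑ z ^ k / (Q; Q)_k = 1 / (z; Q)_∞`. -/
lemma exists_euler_series (hQ : ‖Q‖ < 1) : ∃ K : ℝ,
    (∀ m : ℕ, ‖(∏ i ∈ range m, (1 - Q ^ (i + 1)))⁻¹‖ ≤ K) ∧ ∀ z : ℂ, ‖z‖ < 1 →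
      (∑' m : ℕ, (∏ i ∈ range m, (1 - Q ^ (i + 1)))⁻¹ * z ^ m) * qPochInf z Q = 1 := by
  -- The case r = 0, e = 1: the equation (1 - t) g(t) = g(Qt) characterises 1 / (t; Q)_∞.
  obtain ⟨g, hg⟩ := exists_isProductSeries (Pi.single 0 1) 0 hQ (by simp)
    (fun i hi => by simp [hi.ne'])
  obtain ⟨K, hK⟩ := hg.exists_bound hQ (by simp)
  have hgm : ∀ m : ℕ, g m = (∏ i ∈ range m, (1 - Q ^ (i + 1)))⁻¹ := by
    intro m
    induction m with
    | zero => simp [hg.zero]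
    | succ m ih =>
      have h := hg.sub_eq (m + 1 : ℕ)
      have e1 : ((m + 1 : ℕ) : ℤ) - 1 = m := by push_cast; ring
      rw [e1, ih, zpow_natCast] at h
      simp only [zero_add, range_one, sum_singleton, Pi.single_eq_same, one_mul, Nat.cast_zero,
        sub_zero] at h
      rw [prod_range_succ, mul_inv, eq_mul_inv_iff_mul_eq₀ (one_sub_pow_ne_zero hQ m)]
      linear_combination h
  refine ⟨K, fun m => hgm m ▸ hK m, fun z hz => ?_⟩
  have h := hg.tsum_mul_qPochInf hQ hK sum_range_one_mul_pow hz
  simpa [hgm] using h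

/-- Euler's series provides an explicit inverse. -/
lemma qPochInf_ne_zero {x : ℂ} (hx : ‖x‖ < 1) (hQ : ‖Q‖ < 1) : qPochInf x Q ≠ 0 := by
  obtain ⟨_, _, h⟩ := exists_euler_series hQ
  exact right_ne_zero_of_mul_eq_one (h x hx)

lemma tendsto_gaussShift (hQ : ‖Q‖ < 1) (m : ℕ) :
    Tendsto (fun ℓ : ℕ => gaussShift Q ℓ m) atTop (𝓝 (∏ i ∈ range m, (1 - Q ^ (i + 1)))⁻¹) := by
  rw [← prod_inv_distrib]
  refine tendsto_finsetProd _ fun i _ => ?_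
  have h : Tendsto (fun ℓ : ℕ => (1 - Q ^ (ℓ + (i + 1))) / (1 - Q ^ (i + 1))) atTop
      (𝓝 ((1 - 0) / (1 - Q ^ (i + 1)))) :=
    (((tendsto_add_atTop_iff_nat (i + 1)).mpr
      (tendsto_pow_atTop_nhds_zero_of_norm_lt_one hQ)).const_sub 1).div_const _
  rw [sub_zero, one_div] at h
  refine h.congr fun ℓ => ?_
  norm_cast

lemma tendsto_hermiteTransform {d L : ℂ} (hQ0 : Q ≠ 0) (hQ : ‖Q‖ < 1) (hd : ‖d‖ < 1)
    (hM : ∀ k, ‖f k‖ ≤ M) (hL : Tendsto (fun n : ℕ => f n) atTop (𝓝 L)) :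
    Tendsto (fun ℓ : ℕ => hermiteTransform Q d f ℓ) atTop
      (𝓝 (L * ∑' m : ℕ, (∏ i ∈ range m, (1 - Q ^ (i + 1)))⁻¹ * (-d) ^ m)) := by
  rw [← tsum_mul_left]
  have h1Q : 0 < 1 - ‖Q‖ := by linarith
  refine tendsto_tsum_of_dominated_convergence (bound := fun m => ‖d‖ ^ m *
    (Real.exp (1 / (1 - ‖Q‖)) * Real.exp ((1 - ‖Q‖)⁻¹ / (1 - ‖Q‖))) * M)
    (((summable_geometric_of_lt_one (norm_nonneg d) hd).mul_right _).mul_right _) (fun m => ?_) ?_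
  · have h1 : Tendsto (fun ℓ : ℕ => f (ℓ + m)) atTop (𝓝 L) := by
      refine ((tendsto_add_atTop_iff_nat m).mpr hL).congr fun ℓ => ?_
      push_cast
      rfl
    have h2 := ((tendsto_gaussShift hQ m).const_mul ((-d) ^ m)).mul h1
    convert h2 using 2
    ring
  · refine Eventually.of_forall fun ℓ m => ?_
    rw [norm_mul, norm_mul, norm_pow, norm_neg]
    have h1 := norm_gaussShift_le hQ0 hQ ℓ m
    have h2 := hM (ℓ + m)
    have h3 : ‖Q‖ ^ (ℓ : ℤ) ≤ 1 := by
      rw [zpow_natCast]; exact pow_le_one₀ (norm_nonneg Q) hQ.le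
    have h4 : ‖gaussShift Q ℓ m‖ ≤
        Real.exp (1 / (1 - ‖Q‖)) * Real.exp ((1 - ‖Q‖)⁻¹ / (1 - ‖Q‖)) := by
      refine h1.trans ?_
      gcongr
    gcongr

end analysis

/-! ### Identification of u with the normalised transform, and its limit. -/

/-- A sequence satisfying the recurrence with `q`-powers `y i` in place of `q ^ (-a i)`. -/
theorem tendsto_of_rec {Q d : ℂ} {r : ℕ} {y u : ℕ → ℂ} {e : ℕ → ℂ} (hQ0 : Q ≠ 0) (hQ : ‖Q‖ < 1)
    (hd : ‖d‖ < 1) (hy : ∀ i ∈ Icc 1 r, ‖Q * y i‖ ≤ 1)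
    (he : ∀ t, ∑ i ∈ range (r + 1), e i * t ^ i = ∏ i ∈ Icc 1 r, (1 + y i * t))
    (her : ∀ i, r < i → e i = 0) (hu0 : u 0 = 1)
    (hu : ∀ ℓ : ℕ, 1 ≤ ℓ → (∏ j ∈ Icc 1 r, (1 - d * (Q ^ ℓ * y j))) * u ℓ =
      u (ℓ - 1) + ∑ j ∈ Icc 1 r, (∑ m ∈ range (r - j + 1),
        d ^ m * (Q ^ ℓ * e (j + m) * recBracket Q ℓ ((j : ℤ) + m) m)) *
          (∏ h ∈ Icc 1 (j - 1), (1 - Q ^ ((ℓ : ℤ) - h))) * u (ℓ - j)) :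
    Tendsto u atTop
      (𝓝 (∏ i ∈ Icc 1 r, qPochInf (-(Q * y i)) Q / qPochInf (d * (Q * y i)) Q)) := by
  have he0 : e 0 = 1 := by
    have h := he 0
    rw [sum_range_succ', sum_eq_zero fun i _ => by simp] at h
    simpa using h
  obtain ⟨f, hf⟩ := exists_isProductSeries e r hQ he0 her
  obtain ⟨M, hM⟩ := hf.exists_bound hQ he0
  obtain ⟨L, hL, hLprod⟩ := hf.exists_tendsto hQ hM he
  obtain ⟨_, _, hS⟩ := exists_euler_series hQ
  have hd' : ‖-d‖ < 1 := by rwa [norm_neg]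
  set V := hermiteTransform Q d f with hV
  set P : ℕ → ℂ := fun n => ∏ i ∈ range n, (1 - Q ^ (i + 1)) with hP
  have hdy : ∀ i ∈ Icc 1 r, ‖d * (Q * y i)‖ < 1 := fun i hi =>
    norm_mul_lt_one_of_lt_one hd (hy i hi)
  have hV0 : V 0 * qPochInf (-d) Q = ∏ i ∈ Icc 1 r, qPochInf (d * (Q * y i)) Q := by
    have h := hf.tsum_mul_qPochInf hQ hM he hd'
    have h1 : V 0 = ∑' k : ℕ, f k * (-d) ^ k := by
      rw [hV, hermiteTransform]
      exact tsum_congr fun m => by rw [gaussShift_zero_left hQ, zero_add]; ring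
    rw [h1, h]
    refine prod_congr rfl fun i _ => ?_
    congr 1
    ring
  have hprod0 : ∏ i ∈ Icc 1 r, qPochInf (d * (Q * y i)) Q ≠ 0 :=
    prod_ne_zero_iff.mpr fun i hi => qPochInf_ne_zero (hdy i hi) hQ
  have hV0' : V 0 ≠ 0 := fun h => hprod0 (by rw [← hV0, h, zero_mul])
  -- Normalising by (Q; Q)_ℓ is what produces the product over h in the recurrence.
  have hPsplit : ∀ ℓ j : ℕ, 1 ≤ j → j ≤ ℓ →
      P (ℓ - 1) = (∏ h ∈ Icc 1 (j - 1), (1 - Q ^ ((ℓ : ℤ) - h))) * P (ℓ - j) := by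
    intro ℓ j hj
    induction j, hj using Nat.le_induction with
    | base => intro _; simp
    | succ j hj ih =>
      intro hjℓ
      obtain ⟨j, rfl⟩ : ∃ k, j = k + 1 := ⟨j - 1, by omega⟩
      have e1 : ℓ - (j + 1) = ℓ - (j + 1 + 1) + 1 := by omega
      have e2 : P (ℓ - (j + 1)) = P (ℓ - (j + 1 + 1)) * (1 - Q ^ (ℓ - (j + 1))) := by
        conv_lhs => rw [e1]
        simp only [hP]
        rw [prod_range_succ, ← e1]
      have e3 : Q ^ ((ℓ : ℤ) - (j + 1 : ℕ)) = Q ^ (ℓ - (j + 1)) := by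
        rw [← zpow_natCast]; congr 1; omega
      rw [ih (by omega), Nat.add_sub_cancel, Nat.add_sub_cancel, prod_Icc_succ_top (by omega), e2,
        e3]
      ring
  have hmain : ∀ ℓ : ℕ, P ℓ * V ℓ = V 0 * u ℓ := by
    intro ℓ
    induction ℓ using Nat.strong_induction_on with
    | _ ℓ ih =>
      rcases Nat.eq_zero_or_pos ℓ with rfl | hℓ
      · simp [hP, hu0]
      · have hrec := hf.hermiteTransform_rec he0 hQ0 hQ hd hM ℓ
        rw [← hV, he, zpow_natCast] at hrec
        have hE : ∏ i ∈ Icc 1 r, (1 + y i * -(d * Q ^ ℓ)) =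
            ∏ j ∈ Icc 1 r, (1 - d * (Q ^ ℓ * y j)) := prod_congr rfl fun i _ => by ring
        rw [hE] at hrec
        -- Nonvanishing of the leading factor makes the recurrence determine u_ℓ from earlier terms.
        have hE0 : ∏ j ∈ Icc 1 r, (1 - d * (Q ^ ℓ * y j)) ≠ 0 := by
          refine prod_ne_zero_iff.mpr fun j hj h => ?_
          have h1 : ‖d * (Q ^ ℓ * y j)‖ < 1 := by
            refine norm_mul_lt_one_of_lt_one hd ?_
            have : Q ^ ℓ * y j = Q ^ (ℓ - 1) * (Q * y j) := by
              rw [← mul_assoc, ← pow_succ, Nat.sub_add_cancel hℓ]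
            rw [this, norm_mul, norm_pow]
            exact mul_le_one₀ (pow_le_one₀ (norm_nonneg Q) hQ.le) (norm_nonneg _) (hy j hj)
          rw [← sub_eq_zero.mp h, norm_one] at h1
          exact lt_irrefl _ h1
        have hPℓ : P ℓ = P (ℓ - 1) * (1 - Q ^ ℓ) := by
          obtain ⟨n, rfl⟩ : ∃ n, ℓ = n + 1 := ⟨ℓ - 1, by omega⟩
          simp only [hP, Nat.add_sub_cancel, prod_range_succ]
        have h1 : V ((ℓ : ℤ) - 1) = V (ℓ - 1 : ℕ) := by congr 1; omega
        have hterm : ∀ j ∈ Icc 1 r, P (ℓ - 1) * V ((ℓ : ℤ) - j) =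
            V 0 * ((∏ h ∈ Icc 1 (j - 1), (1 - Q ^ ((ℓ : ℤ) - h))) * u (ℓ - j)) := by
          intro j hj
          have hj1 := (mem_Icc.mp hj).1
          rcases le_or_gt j ℓ with hjℓ | hjℓ
          · have h2 : (ℓ : ℤ) - j = (ℓ - j : ℕ) := by omega
            rw [hPsplit ℓ j hj1 hjℓ]
            have h3 := ih (ℓ - j) (by omega)
            rw [← h2] at h3
            linear_combination (∏ h ∈ Icc 1 (j - 1), (1 - Q ^ ((ℓ : ℤ) - h))) * h3
          -- For j > ℓ both sides are zero: V at a negative index, and the factor h = ℓ of the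
          -- product.
          · rw [hV, hermiteTransform_of_neg Q d f hf.of_neg _ (by omega),
              prod_eq_zero (i := ℓ) (mem_Icc.mpr ⟨hℓ, by omega⟩) (by simp)]
            ring
        apply mul_left_cancel₀ hE0
        have h4 : (∏ j ∈ Icc 1 r, (1 - d * (Q ^ ℓ * y j))) * (P ℓ * V ℓ) =
            P (ℓ - 1) * ((1 - Q ^ ℓ) * (∏ j ∈ Icc 1 r, (1 - d * (Q ^ ℓ * y j))) * V ℓ) := by
          rw [hPℓ]; ring
        have h5 : (∏ j ∈ Icc 1 r, (1 - d * (Q ^ ℓ * y j))) * (V 0 * u ℓ) =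
            V 0 * ((∏ j ∈ Icc 1 r, (1 - d * (Q ^ ℓ * y j))) * u ℓ) := by ring
        rw [h4, hrec, h5, hu ℓ hℓ, mul_add, mul_add, h1, ih (ℓ - 1) (by omega), mul_sum, mul_sum]
        congr 1
        refine sum_congr rfl fun j hj => ?_
        linear_combination (∑ m ∈ range (r - j + 1),
          d ^ m * (Q ^ ℓ * e (j + m) * recBracket Q ℓ ((j : ℤ) + m) m)) * hterm j hj
  have hu' : u = fun ℓ => P ℓ * V ℓ / V 0 := by
    funext ℓ
    rw [hmain ℓ, mul_div_cancel_left₀ _ hV0']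
  have hPlim : Tendsto P atTop (𝓝 (qPochInf Q Q)) := by
    refine (tendsto_qPochInf Q hQ).congr fun n => ?_
    exact prod_congr rfl fun i _ => by rw [pow_succ']
  have hlim := (hPlim.mul (tendsto_hermiteTransform hQ0 hQ hd hM hL)).div_const (V 0)
  rw [hu']
  convert hlim using 2
  have hSd := hS (-d) hd'
  rw [prod_div_distrib, ← hV0, ← hLprod]
  have h0 := right_ne_zero_of_mul_eq_one hSd
  rw [div_eq_div_iff (mul_ne_zero hV0' h0) hV0']
  linear_combination (-(L * qPochInf Q Q * V 0)) * hSd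

/-! ### Subset sums and elementary symmetric polynomials. -/

lemma pos_of_sum_lt {a : ℕ → ℤ} {r : ℕ} (ha : ∀ k ∈ Icc 1 r, ∑ i ∈ Ico 1 k, a i < a k) :
    ∀ k ∈ Icc 1 r, 0 < a k := by
  intro k
  induction k using Nat.strong_induction_on with
  | _ k ih =>
    intro hk
    refine lt_of_le_of_lt (sum_nonneg fun i hi => (ih i (mem_Ico.mp hi).2 ?_).le) (ha k hk)
    have := mem_Icc.mp hk
    have := mem_Ico.mp hi
    exact mem_Icc.mpr (by omega)

lemma prod_zpow_neg {q : ℂ} (hq0 : q ≠ 0) (a : ℕ → ℤ) (S : Finset ℕ) :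
    ∏ i ∈ S, q ^ (-a i) = q ^ (-∑ i ∈ S, a i) := by
  induction S using Finset.induction_on with
  | empty => simp
  | insert i S hi ih => rw [prod_insert hi, sum_insert hi, ih, ← zpow_add₀ hq0, neg_add]

lemma sum_powersetCard_mul_pow (I : Finset ℕ) (y : ℕ → ℂ) (t : ℂ) :
    ∑ k ∈ range (#I + 1), (∑ S ∈ powersetCard k I, ∏ i ∈ S, y i) * t ^ k =
      ∏ i ∈ I, (1 + y i * t) := by
  rw [prod_one_add, sum_powerset]
  refine sum_congr rfl fun k _ => ?_
  rw [sum_mul]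
  refine sum_congr rfl fun S hS => ?_
  rw [prod_mul_distrib, prod_const, (mem_powersetCard.mp hS).2]

/-- No sum of distinct elements is cut off by the condition `α < a (r + 1)`. -/
lemma filter_subsetSums {r : ℕ} (hr : 1 ≤ r) {a : ℕ → ℤ} (hpos : ∀ k ∈ Icc 1 r, 0 < a k)
    (hA : Set.InjOn (fun S : Finset ℕ => ∑ i ∈ S, a i)
      {S : Finset ℕ | S ⊆ Icc 1 r ∧ S.Nonempty})
    {N : ℕ} (hN : ∑ i ∈ Icc 1 r, a i ≤ (N : ℤ)) {k : ℕ} (hk : 1 ≤ k) :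
    (subsetSums a r).filter (fun α => α < (N : ℤ) + a 1 ∧ weight a r α = k) =
      (powersetCard k (Icc 1 r)).image fun S => ∑ i ∈ S, a i := by
  ext α
  simp only [subsetSums, mem_filter, mem_image, mem_powerset, mem_powersetCard]
  constructor
  · rintro ⟨⟨S, ⟨hS, hne⟩, rfl⟩, _, hw⟩
    exact ⟨S, ⟨hS, by rwa [weight_sum a r hA S hS hne] at hw⟩, rfl⟩
  · rintro ⟨S, ⟨hS, hc⟩, rfl⟩
    have hne : S.Nonempty := card_pos.mp (by omega)
    refine ⟨⟨S, ⟨hS, hne⟩, rfl⟩, ?_, by rw [weight_sum a r hA S hS hne, hc]⟩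
    have h1 := hpos 1 (mem_Icc.mpr ⟨le_rfl, hr⟩)
    have h2 : ∑ i ∈ S, a i ≤ ∑ i ∈ Icc 1 r, a i :=
      sum_le_sum_of_subset_of_nonneg hS fun i hi _ => (hpos i hi).le
    omega

/-- The bracket does not depend on α, so the inner sum factors; as distinct subsets have distinct
sums, the sum of q^(-α) over weight j + m is e_{j+m}. -/
lemma recCoeff_eq {r : ℕ} (hr : 1 ≤ r) {a : ℕ → ℤ} (hpos : ∀ k ∈ Icc 1 r, 0 < a k)
    (hA : Set.InjOn (fun S : Finset ℕ => ∑ i ∈ S, a i)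
      {S : Finset ℕ | S ⊆ Icc 1 r ∧ S.Nonempty})
    {N : ℕ} (hN : ∑ i ∈ Icc 1 r, a i ≤ (N : ℤ)) {q : ℂ} (hq0 : q ≠ 0) (d : ℂ) (ℓ : ℕ) {j : ℕ}
    (hj : 1 ≤ j) :
    recCoeff a r N q d ℓ j = ∑ m ∈ range (r - j + 1), d ^ m * ((q ^ N) ^ ℓ *
      (∑ S ∈ powersetCard (j + m) (Icc 1 r), ∏ i ∈ S, q ^ (-a i)) *
        recBracket (q ^ N) ℓ ((j : ℤ) + m) m) := by
  refine sum_congr rfl fun m _ => ?_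
  congr 1
  rw [← sum_mul]
  congr 1
  · rw [filter_subsetSums hr hpos hA hN (by omega), sum_image, mul_sum]
    · refine sum_congr rfl fun S _ => ?_
      rw [prod_zpow_neg hq0, sub_eq_add_neg, zpow_add₀ hq0, mul_comm (ℓ : ℤ), zpow_mul]
      norm_cast
    · intro S hS T hT h
      rw [mem_coe, mem_powersetCard] at hS hT
      refine hA ⟨hS.1, card_pos.mp ?_⟩ ⟨hT.1, card_pos.mp ?_⟩ h
      · rw [hS.2]; omega
      · rw [hT.2]; omega
  · have h1 : q ^ (-(N : ℤ)) = (q ^ N)⁻¹ := by simp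
    have h2 : q ^ ((ℓ : ℤ) * ((m : ℤ) - 1) * N) = (q ^ N) ^ ((ℓ : ℤ) * ((m : ℤ) - 1)) := by
      rw [mul_comm, zpow_mul, zpow_natCast]
    have h3 : q ^ (ℓ * m * N) = (q ^ N) ^ ((ℓ : ℤ) * m) := by
      rw [mul_comm, pow_mul]
      norm_cast
    rw [recBracket, h1, h2, h3]

end SchurOverpartition

theorem theorem6 (r : ℕ) (hr : 1 ≤ r) (a : ℕ → ℤ)
    (ha : ∀ k ∈ Finset.Icc 1 r, ∑ i ∈ Finset.Ico 1 k, a i < a k)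
    (hA : Set.InjOn (fun S : Finset ℕ => ∑ i ∈ S, a i)
      {S : Finset ℕ | S ⊆ Finset.Icc 1 r ∧ S.Nonempty})
    (N : ℕ) (hN : ∑ i ∈ Finset.Icc 1 r, a i ≤ (N : ℤ))
    (q d : ℂ) (hq0 : q ≠ 0) (hq : ‖q‖ < 1) (hd : ‖d‖ < 1)
    (u : ℕ → ℂ) (hu0 : u 0 = 1) (hu : SchurOverpartition.SatisfiesRec a r N q d u) :
    Filter.Tendsto u Filter.atTop (nhds
      (∏ k ∈ Finset.Icc 1 r,
        SchurOverpartition.qPochInf (-q ^ ((N : ℤ) - a k)) (q ^ N) /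
          SchurOverpartition.qPochInf (d * q ^ ((N : ℤ) - a k)) (q ^ N))) := by
  have hpos := SchurOverpartition.pos_of_sum_lt ha
  have hle : ∀ i ∈ Finset.Icc 1 r, a i ≤ N := fun i hi =>
    (Finset.single_le_sum (fun j hj => (hpos j hj).le) hi).trans hN
  have h1 : 1 ∈ Finset.Icc 1 r := Finset.mem_Icc.mpr ⟨le_rfl, hr⟩
  have hN0 : N ≠ 0 := by
    have := hpos 1 h1
    have := hle 1 h1
    omega
  have hQ : ‖q ^ N‖ < 1 := by
    rw [norm_pow]
    exact pow_lt_one₀ (norm_nonneg q) hq hN0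
  have hQy : ∀ i, q ^ N * q ^ (-a i) = q ^ ((N : ℤ) - a i) := fun i => by
    rw [sub_eq_add_neg, zpow_add₀ hq0, zpow_natCast]
  -- The exponent N - a(i) may be 0, so only ≤ 1 holds; strictness later comes from ‖d‖ < 1.
  have hy : ∀ i ∈ Finset.Icc 1 r, ‖q ^ N * q ^ (-a i)‖ ≤ 1 := by
    intro i hi
    obtain ⟨n, hn⟩ := Int.eq_ofNat_of_zero_le (sub_nonneg.mpr (hle i hi))
    rw [hQy, hn, zpow_natCast, norm_pow]
    exact pow_le_one₀ (norm_nonneg q) hq.le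
  have he := SchurOverpartition.sum_powersetCard_mul_pow (Finset.Icc 1 r) fun i => q ^ (-a i)
  rw [Nat.card_Icc, Nat.add_sub_cancel] at he
  have hrec : ∀ ℓ : ℕ, 1 ≤ ℓ →
      (∏ j ∈ Finset.Icc 1 r, (1 - d * ((q ^ N) ^ ℓ * q ^ (-a j)))) * u ℓ =
      u (ℓ - 1) + ∑ j ∈ Finset.Icc 1 r, (∑ m ∈ Finset.range (r - j + 1), d ^ m * ((q ^ N) ^ ℓ *
        (∑ S ∈ Finset.powersetCard (j + m) (Finset.Icc 1 r), ∏ i ∈ S, q ^ (-a i)) *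
          SchurOverpartition.recBracket (q ^ N) ℓ ((j : ℤ) + m) m)) *
        (∏ h ∈ Finset.Icc 1 (j - 1), (1 - (q ^ N) ^ ((ℓ : ℤ) - h))) * u (ℓ - j) := by
    intro ℓ hℓ
    have e1 : ∀ j, q ^ ((ℓ : ℤ) * N - a j) = (q ^ N) ^ ℓ * q ^ (-a j) := fun j => by
      rw [sub_eq_add_neg, zpow_add₀ hq0, mul_comm (ℓ : ℤ), zpow_mul, zpow_natCast, zpow_natCast]
    have e2 : ∀ j : ℕ, q ^ (((ℓ : ℤ) - j) * N) = (q ^ N) ^ ((ℓ : ℤ) - j) := fun j => by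
      rw [mul_comm, zpow_mul, zpow_natCast]
    have h := hu ℓ hℓ
    simp only [e1, e2] at h
    refine h.trans (congrArg _ (Finset.sum_congr rfl fun j hj => ?_))
    rw [SchurOverpartition.recCoeff_eq hr hpos hA hN hq0 d ℓ (Finset.mem_Icc.mp hj).1]
  have key := SchurOverpartition.tendsto_of_rec (u := u) (y := fun i => q ^ (-a i))
    (e := fun k => ∑ S ∈ Finset.powersetCard k (Finset.Icc 1 r), ∏ i ∈ S, q ^ (-a i))
    (pow_ne_zero N hq0) hQ hd hy he
    (fun i hi => by
      rw [Finset.powersetCard_eq_empty.mpr (by simpa using hi), Finset.sum_empty])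
    hu0 hrec
  simpa only [hQy] using key
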